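/- Throw $m\ge 1$ balls, independently and uniformly at random, into $n\ge 3m$ bins. Let $i\ge 1$ be an integer, let $L_i$ be the number of balls that are contained in bins with $i$ or more balls, and let $M_i$ be the median of $L_i$, that is, the infimum of the values $v$ with $\Pr[L_i<v]\le 1/2$ and $\Pr[L_i>v]\le 1/2$. Let $c>0$ be a real number, and assume that $M_i\ge 16\,i^2c\log m$, where $\log$ is the natural logarithm. There is an absolute constant $c'>0$ (independent of $m,n,i,c$) such that the following holds. 1. If $m$ is large enough in terms of $c$, namely $m^c\ge 4$, then $$\Pr\Bigl[\,|L_i-M_i|\ \ge\ 4i\sqrt{c\,M_i\log m}\,\Bigr]\ \le\ \frac1{m^c}.$$ 2. $\bigl|M_i-\mathbb E[L_i]\bigr|\ \le\ c'\,i\sqrt{M_i}$. 3. $$\Pr\Bigl[\,|L_i-\mathbb E[L_i]|\ \ge\ c'\,i\sqrt{M_i}+4i\sqrt{c\,M_i\log m}\,\Bigr]\ \le\ \frac1{m^c}.$$ -/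

import Mathlib

open MeasureTheory ProbabilityTheory

/-- The median of a real-valued random variable `f` on `(Ω, P)`: the infimum of the values `v` such
that `P[f < v] ≤ 1/2` and `P[f > v] ≤ 1/2`. -/
noncomputable def rvMedian {Ω : Type*} [MeasurableSpace Ω] (P : Measure Ω) (f : Ω → ℝ) : ℝ :=
  sInf {v : ℝ | P.real {ω | f ω < v} ≤ 1 / 2 ∧ P.real {ω | v < f ω} ≤ 1 / 2}

/-- The law of throwing `m` balls into `n` bins: each ball falls, independently of the others, into
a uniformly random bin. An outcome `x` sends the ball `j` to the bin `x j`. -/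
noncomputable def ballsIntoBins (m n : ℕ) : Measure (Fin m → Fin n) :=
  Measure.pi fun _ : Fin m => uniformOn (Set.univ : Set (Fin n))

/-- The number of balls contained in bins that contain `i` or more balls. -/
def heavyBalls {m n : ℕ} (i : ℕ) (x : Fin m → Fin n) : ℕ :=
  (Finset.univ.filter fun j : Fin m =>
    i ≤ (Finset.univ.filter fun k : Fin m => x k = x j).card).card

/-- The number of `i`-heavy balls as a real random variable. -/
def heavyBallsRV (m n i : ℕ) : (Fin m → Fin n) → ℝ := fun x => (heavyBalls i x : ℝ)

/-- The median of the number of `i`-heavy balls when `m` balls are thrown into `n` bins. -/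
noncomputable def heavyMedian (m n i : ℕ) : ℝ :=
  rvMedian (ballsIntoBins m n) (heavyBallsRV m n i)

/-- The expectation of the number of `i`-heavy balls when `m` balls are thrown into `n` bins. -/
noncomputable def heavyMean (m n i : ℕ) : ℝ :=
  ∫ x, heavyBallsRV m n i x ∂(ballsIntoBins m n)

/-! Concentration around the median is Talagrand's method of certificates. If `L_i ≥ s`, then a set
`I` of at most `s + i` balls, each sharing its bin with at least `i` balls of `I`, witnesses this.
Moving one ball creates at most `i` heavy balls, so an outcome with `L_i ≤ s - t` differs from the
witness in at least `t / i` coordinates of `I`. Talagrand's inequality (`exists_dominatesDist`) then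
bounds the product of the probabilities of `L_i ≤ a` and `L_i ≥ a + t` by `exp (-t² / (4 i² (a + t +
i)))`. Taking `a = M` or `a + t = M`, one factor is at least 1/2 and the other is a tail.

The median and the mean are compared by Chebyshev. Loads of distinct bins are negatively correlated
(`sum_mul_load_le`), and for `n ≥ 3m` one bin's contribution has second moment at most `2i` times
its mean (`sum_heavyLoad_sq_le`), so `Var L_i ≤ 2i E[L_i]`. A positive median is at least `i`, which
gives `E[L_i] ≤ 6M` and hence a gap of order `i √M`. The third claim follows by the triangle
inequality when `m^c ≥ 4`, and from Chebyshev alone otherwise. -/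

/-! ### Talagrand's inequality on a finite power -/

/-- The scalar inequality behind Talagrand's induction: `exp (-s)` will be the relative size of a
section, and `s - s²` the exponent after optimising the interpolation weight. -/
theorem exp_sub_sq_le {s : ℝ} (h0 : 0 ≤ s) (h1 : s ≤ 1 / 2) :
    Real.exp (s - s ^ 2) ≤ 2 - Real.exp (-s) := by
  have hw0 : 0 ≤ s - s ^ 2 := by nlinarith
  have hws : s - s ^ 2 ≤ s := by nlinarith [sq_nonneg s]
  have hA := Real.exp_bound' hw0 (by linarith) (n := 3) (by norm_num)
  simp only [Finset.sum_range_succ, Finset.sum_range_zero, Nat.factorial] at hA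
  norm_num at hA
  have hB : Real.exp (-s) ≤ 1 - s + s ^ 2 / 2 := by
    have h := Real.quadratic_le_exp_of_nonneg h0
    have hp := Real.exp_pos (-s)
    have he : Real.exp (-s) * Real.exp s = 1 := by rw [← Real.exp_add]; simp
    have h4 : 0 ≤ 1 - s + s ^ 2 / 2 := by nlinarith [sq_nonneg s]
    by_contra! hc
    have : (1 - s + s ^ 2 / 2) * (1 + s + s ^ 2 / 2) < 1 := by
      calc _ ≤ (1 - s + s ^ 2 / 2) * Real.exp s := by gcongr
        _ < Real.exp (-s) * Real.exp s := by gcongr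
        _ = 1 := he
    nlinarith [pow_nonneg h0 4]
  have hC : (s - s ^ 2) ^ 3 ≤ s ^ 3 := by gcongr
  nlinarith [pow_nonneg h0 3, pow_nonneg h0 4, mul_nonneg (pow_nonneg h0 3) (sub_nonneg.2 h1)]

theorem sum_pi_fin_succ {α M : Type*} [Fintype α] [AddCommMonoid M] {m : ℕ}
    (F : (Fin (m + 1) → α) → M) :
    ∑ x, F x = ∑ a, ∑ z : Fin m → α, F (Fin.cons a z) := by
  rw [← Fintype.sum_prod_type']
  exact (Equiv.sum_comp (Fin.consEquiv fun _ : Fin (m + 1) => α) F).symm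

/-- The number of coordinates in `I` at which `x` and `y` differ. -/
def diffCount {α : Type*} [DecidableEq α] {m : ℕ} (I : Finset (Fin m)) (x y : Fin m → α) : ℕ :=
  (Finset.univ.filter fun j => j ∈ I ∧ x j ≠ y j).card

/-- The coordinates of `I` other than the first. -/
def tailCoords {m : ℕ} (I : Finset (Fin (m + 1))) : Finset (Fin m) :=
  Finset.univ.filter fun j => j.succ ∈ I

theorem card_eq_tailCoords {m : ℕ} (I : Finset (Fin (m + 1))) :
    I.card = (if 0 ∈ I then 1 else 0) + (tailCoords I).card := by
  have h := Fin.card_filter_univ_succ' (fun j => j ∈ I)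
  simpa [tailCoords] using h

theorem diffCount_cons {α : Type*} [DecidableEq α] {m : ℕ} (I : Finset (Fin (m + 1))) (a b : α)
    (x y : Fin m → α) :
    diffCount I (Fin.cons a x : Fin (m + 1) → α) (Fin.cons b y) =
      (if 0 ∈ I ∧ a ≠ b then 1 else 0) + diffCount (tailCoords I) x y := by
  unfold diffCount
  rw [Fin.card_filter_univ_succ']
  simp [tailCoords]

/-- Cauchy–Schwarz for `(1, √k)` and `(a, √p)`: a certificate of size `k` gains one coordinate at
additive cost `a²`. -/
theorem sq_add_le_of_sq_le {a v k p : ℝ} (hk : 0 ≤ k) (h : v ^ 2 ≤ k * p) (hp : 0 ≤ p) :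
    (a + v) ^ 2 ≤ (1 + k) * (a ^ 2 + p) := by
  have h2 : 2 * (a * v) ≤ k * a ^ 2 + p := by
    apply le_of_abs_le
    apply abs_le_of_sq_le_sq _ (by positivity)
    nlinarith [sq_nonneg (k * a ^ 2 - p), mul_le_mul_of_nonneg_left h (sq_nonneg a)]
  nlinarith

/-- Hölder's inequality with exponents `1/l` and `1/(1-l)`, obtained pointwise from convexity of
`exp` after normalising both sums to at most 1. -/
theorem sum_exp_interpolation_le {ι : Type*} [Fintype ι] {f g : ι → ℝ} {K p q l : ℝ} (hK : 0 < K)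
    (hp : 0 < p) (hq : 0 < q) (hl0 : 0 ≤ l) (hl1 : l ≤ 1)
    (hf : p * ∑ z, Real.exp (f z / 4) ≤ K) (hg : q * ∑ z, Real.exp (g z / 4) ≤ K) :
    q * ∑ z, Real.exp (((1 - l) ^ 2 + l * f z + (1 - l) * g z) / 4) ≤
      K * Real.exp ((1 - l) ^ 2 / 4 - l * Real.log (p / q)) := by
  have key : ∀ z, Real.exp (((1 - l) ^ 2 + l * f z + (1 - l) * g z) / 4) ≤
      (K / q) * Real.exp ((1 - l) ^ 2 / 4 - l * Real.log (p / q)) *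
        (l * (p / K * Real.exp (f z / 4)) + (1 - l) * (q / K * Real.exp (g z / 4))) := by
    intro z
    have hc := convexOn_exp.2 (Set.mem_univ (f z / 4 + Real.log (p / K)))
      (Set.mem_univ (g z / 4 + Real.log (q / K))) hl0 (sub_nonneg.2 hl1) (by ring)
    simp only [smul_eq_mul] at hc
    rw [Real.exp_add (f z / 4), Real.exp_add (g z / 4), Real.exp_log (div_pos hp hK),
      Real.exp_log (div_pos hq hK)] at hc
    have he : Real.exp (((1 - l) ^ 2 + l * f z + (1 - l) * g z) / 4) =
        (K / q) * Real.exp ((1 - l) ^ 2 / 4 - l * Real.log (p / q)) *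
        Real.exp (l * (f z / 4 + Real.log (p / K)) + (1 - l) * (g z / 4 + Real.log (q / K))) := by
      rw [← Real.exp_log (div_pos hK hq), ← Real.exp_add, ← Real.exp_add,
        Real.log_div hK.ne' hq.ne', Real.log_div hp.ne' hq.ne', Real.log_div hp.ne' hK.ne',
        Real.log_div hq.ne' hK.ne']
      congr 1
      ring
    rw [he]
    refine mul_le_mul_of_nonneg_left ?_ (by positivity)
    refine hc.trans (le_of_eq (by ring))
  have hs := Finset.sum_le_sum fun z (_ : z ∈ Finset.univ) => key z
  rw [← Finset.mul_sum, Finset.sum_add_distrib, ← Finset.mul_sum, ← Finset.mul_sum,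
    ← Finset.mul_sum, ← Finset.mul_sum] at hs
  have h1 : p / K * ∑ z, Real.exp (f z / 4) ≤ 1 := by
    rw [div_mul_eq_mul_div, div_le_one hK]; exact hf
  have h2 : q / K * ∑ z, Real.exp (g z / 4) ≤ 1 := by
    rw [div_mul_eq_mul_div, div_le_one hK]; exact hg
  have h3 : l * (p / K * ∑ z, Real.exp (f z / 4)) + (1 - l) * (q / K * ∑ z, Real.exp (g z / 4))
      ≤ 1 := by nlinarith
  have h4 := hs.trans (mul_le_of_le_one_right (by positivity) h3)
  calc _ ≤ q * (K / q * Real.exp ((1 - l) ^ 2 / 4 - l * Real.log (p / q))) := by gcongr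
    _ = _ := by field_simp

/-- A function that dominates the squared distance to `A`, normalised by certificate size. -/
def DominatesDist {α : Type*} [DecidableEq α] {m : ℕ} (A : Finset (Fin m → α))
    (ψ : (Fin m → α) → ℝ) : Prop :=
  (∀ y, 0 ≤ ψ y) ∧ ∀ y (I : Finset (Fin m)) (u : ℝ), 0 ≤ u →
    (∀ x ∈ A, u ≤ diffCount I x y) → u ^ 2 ≤ I.card * ψ y

/-- From `(ω, z)` one reaches `A` either by keeping `ω` and moving `z` into the section, or by
giving up the first coordinate and moving `z` into the projection. Mixing the two bounds with
weights `l` and `1 - l` costs `(1 - l)²`. For `l = 0` the section may be empty, so nothing is asked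
of `f` beyond nonnegativity. -/
theorem dominates_interpolation {α : Type*} [DecidableEq α] {m : ℕ} {A : Finset (Fin (m + 1) → α)}
    {Aω B : Finset (Fin m → α)} {ω : α} (hAω : ∀ z ∈ Aω, (Fin.cons ω z : Fin (m + 1) → α) ∈ A)
    (hB : ∀ z ∈ B, ∃ a, (Fin.cons a z : Fin (m + 1) → α) ∈ A) {f g : (Fin m → α) → ℝ} {l : ℝ}
    (hl0 : 0 ≤ l) (hl1 : l ≤ 1) (hf : l = 0 ∨ DominatesDist Aω f) (hf0 : ∀ z, 0 ≤ f z)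
    (hg : DominatesDist B g)
    (z : Fin m → α) (I : Finset (Fin (m + 1))) (u : ℝ) (hu : 0 ≤ u)
    (hI : ∀ x ∈ A, u ≤ diffCount I x (Fin.cons ω z)) :
    u ^ 2 ≤ I.card * ((1 - l) ^ 2 + l * f z + (1 - l) * g z) := by
  have hωz : ∀ x ∈ Aω, u ≤ diffCount (tailCoords I) x z := by
    intro x hx
    simpa [diffCount_cons] using hI _ (hAω x hx)
  have hBz : ∀ x ∈ B, u - (if 0 ∈ I then 1 else 0) ≤ diffCount (tailCoords I) x z := by
    intro x hx
    obtain ⟨a, ha⟩ := hB x hx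
    have h := hI _ ha
    rw [diffCount_cons] at h
    push_cast at h
    split_ifs at h ⊢ <;> first | tauto | linarith
  set k : ℝ := ((tailCoords I).card : ℝ) with hk
  have hk0 : 0 ≤ k := by positivity
  set e : ℝ := if 0 ∈ I then 1 else 0 with he
  have hcard : (I.card : ℝ) = e + k := by rw [card_eq_tailCoords]; push_cast; rfl
  -- `u - e` can be negative, whereas `DominatesDist` only accepts nonnegative distances.
  set q : ℝ := max (u - e) 0 with hq
  have hq0 : 0 ≤ q := le_max_right _ _
  have hgq : q ^ 2 ≤ k * g z := hg.2 z _ q hq0 fun x hx => max_le (hBz x hx) (Nat.cast_nonneg _)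
  have hfu : l * u ^ 2 ≤ l * (k * f z) := by
    rcases hf with h | h
    · simp [h]
    · exact mul_le_mul_of_nonneg_left (h.2 z _ u hu hωz) hl0
  have hv : (l * u + (1 - l) * q) ^ 2 ≤ k * (l * f z + (1 - l) * g z) := by
    have h1 : (l * u + (1 - l) * q) ^ 2 ≤ l * u ^ 2 + (1 - l) * q ^ 2 := by
      nlinarith [mul_nonneg (mul_nonneg hl0 (sub_nonneg.2 hl1)) (sq_nonneg (u - q))]
    nlinarith [mul_le_mul_of_nonneg_left hgq (sub_nonneg.2 hl1)]
  have hp0 : 0 ≤ l * f z + (1 - l) * g z :=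
    add_nonneg (mul_nonneg hl0 (hf0 z)) (mul_nonneg (sub_nonneg.2 hl1) (hg.1 z))
  have hqu : u - e ≤ q := le_max_left _ _
  rw [hcard]
  by_cases h0 : 0 ∈ I
  · simp only [he, h0, if_true] at hqu ⊢
    have h := sq_add_le_of_sq_le (a := 1 - l) hk0 hv hp0
    have hle : u ≤ 1 - l + (l * u + (1 - l) * q) := by nlinarith
    calc u ^ 2 ≤ (1 - l + (l * u + (1 - l) * q)) ^ 2 := by gcongr
      _ ≤ _ := by rw [add_assoc ((1 - l) ^ 2)]; exact h
  · simp only [he, h0, if_false] at hqu ⊢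
    have hle : u ≤ l * u + (1 - l) * q := by nlinarith
    calc u ^ 2 ≤ (l * u + (1 - l) * q) ^ 2 := by gcongr
      _ ≤ _ := hv
      _ ≤ _ := by nlinarith [mul_nonneg hk0 (sq_nonneg (1 - l))]

set_option maxHeartbeats 1000000 in
/-- **Talagrand's convex distance inequality** for the uniform measure on a finite power. -/
theorem exists_dominatesDist {α : Type*} [Fintype α] [DecidableEq α] (m : ℕ) :
    ∀ A : Finset (Fin m → α), A.Nonempty → ∃ ψ, DominatesDist A ψ ∧
      A.card * ∑ y, Real.exp (ψ y / 4) ≤ ((Fintype.card α : ℝ) ^ m) ^ 2 := by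
  induction m with
  | zero =>
    intro A hA
    refine ⟨0, ⟨fun _ => le_rfl, ?_⟩, ?_⟩
    · intro y I u hu h
      obtain ⟨x, hx⟩ := hA
      have := h x hx
      have hd : diffCount I x y = 0 := by simp [diffCount]
      rw [hd] at this
      have : u = 0 := le_antisymm (by simpa using this) hu
      simp [this]
    · have h : A.card ≤ 1 := by simpa using Finset.card_le_univ A
      have : (A.card : ℝ) ≤ 1 := by exact_mod_cast h
      simpa using this
  | succ m ih =>
    intro A hA
    set N : ℝ := (Fintype.card α : ℝ) with hN
    set S : α → Finset (Fin m → α) := fun ω =>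
      Finset.univ.filter fun z => (Fin.cons ω z : Fin (m + 1) → α) ∈ A with hS
    set B : Finset (Fin m → α) := Finset.univ.filter fun z => ∃ a, z ∈ S a with hBdef
    have hSB : ∀ ω, S ω ⊆ B := fun ω z hz => by
      simp only [hBdef, Finset.mem_filter, Finset.mem_univ, true_and]; exact ⟨ω, hz⟩
    have hBne : B.Nonempty := by
      obtain ⟨x, hx⟩ := hA
      refine ⟨Fin.tail x, hSB (x 0) ?_⟩
      simp [hS, hx]
    obtain ⟨g, hg, hgB⟩ := ih B hBne
    have hN0 : 0 < N := by
      obtain ⟨x, hx⟩ := hA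
      have : Nonempty α := ⟨x 0⟩
      simp only [hN]; exact_mod_cast Fintype.card_pos
    set K : ℝ := (N ^ m) ^ 2 with hK
    have hK0 : 0 < K := by positivity
    have hb0 : 0 < (B.card : ℝ) := by exact_mod_cast hBne.card_pos
    have hcover : ∀ z ∈ B, ∃ a, (Fin.cons a z : Fin (m + 1) → α) ∈ A := by
      intro z hz; simpa [hBdef, hS] using hz
    have hmemS : ∀ ω, ∀ z ∈ S ω, (Fin.cons ω z : Fin (m + 1) → α) ∈ A := by
      intro ω z hz; simpa [hS] using hz
    have step : ∀ ω, ∃ f : (Fin m → α) → ℝ, (∀ z, 0 ≤ f z) ∧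
        (∀ z (I : Finset (Fin (m + 1))) (u : ℝ), 0 ≤ u →
          (∀ x ∈ A, u ≤ diffCount I x (Fin.cons ω z)) → u ^ 2 ≤ I.card * f z) ∧
        (B.card : ℝ) ^ 2 * ∑ z, Real.exp (f z / 4) ≤ K * (2 * B.card - (S ω).card) := by
      intro ω
      have hle : ((S ω).card : ℝ) ≤ B.card := by exact_mod_cast Finset.card_le_card (hSB ω)
      -- With `exp (-s)` the ratio of section to projection, `(1 - l)² / 4 + l s` is minimal at `l =
      -- 1 - 2s`. This weight is nonnegative exactly when `s ≤ 1/2`; for smaller sections `l = 0` is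
      -- used.
      by_cases hr : Real.exp (-(1 / 2)) * B.card ≤ (S ω).card
      · have hs0 : 0 < ((S ω).card : ℝ) := lt_of_lt_of_le (by positivity) hr
        have hSne : (S ω).Nonempty := Finset.card_pos.1 (by exact_mod_cast hs0)
        obtain ⟨f, hf, hfS⟩ := ih (S ω) hSne
        set s : ℝ := -Real.log ((S ω).card / B.card) with hs
        have hr0 : 0 < ((S ω).card : ℝ) / B.card := by positivity
        have hs1 : 0 ≤ s := by
          rw [hs, neg_nonneg]
          exact Real.log_nonpos hr0.le ((div_le_one hb0).2 hle)
        have hs2 : s ≤ 1 / 2 := by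
          rw [hs, neg_le, Real.le_log_iff_exp_le hr0, le_div_iff₀ hb0]
          exact hr
        have hl0 : 0 ≤ 1 - 2 * s := by linarith
        have hl1 : 1 - 2 * s ≤ 1 := by linarith
        refine ⟨fun z => (1 - (1 - 2 * s)) ^ 2 + (1 - 2 * s) * f z + (1 - (1 - 2 * s)) * g z,
          ?_, ?_, ?_⟩
        · intro z
          have h1 := mul_nonneg hl0 (hf.1 z)
          have h2 := mul_nonneg (sub_nonneg.2 hl1) (hg.1 z)
          have h3 := sq_nonneg (1 - (1 - 2 * s))
          linarith
        · intro z I u hu hI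
          exact dominates_interpolation (hmemS ω) hcover hl0 hl1 (Or.inr hf) hf.1 hg z I u hu hI
        · have h := sum_exp_interpolation_le hK0 hs0 hb0 hl0 hl1 hfS hgB
          have he : (1 - (1 - 2 * s)) ^ 2 / 4 -
              (1 - 2 * s) * Real.log ((S ω).card / B.card) = s - s ^ 2 := by
            have : Real.log ((S ω).card / B.card) = -s := by rw [hs]; ring
            rw [this]; ring
          rw [he] at h
          have h2 := exp_sub_sq_le hs1 hs2
          have h3 : Real.exp (-s) = (S ω).card / B.card := by
            rw [hs, neg_neg, Real.exp_log hr0]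
          rw [h3] at h2
          rw [sq, mul_assoc]
          calc _ ≤ (B.card : ℝ) * (K * Real.exp (s - s ^ 2)) := by gcongr
            _ ≤ (B.card : ℝ) * (K * (2 - (S ω).card / B.card)) := by gcongr
            _ = _ := by
              have h4 : (B.card : ℝ) * ((S ω).card / B.card) = (S ω).card :=
                mul_div_cancel₀ _ hb0.ne'
              linear_combination (-K) * h4
      · push Not at hr
        refine ⟨fun z => (1 - 0) ^ 2 + 0 * (0 : ℝ) + (1 - 0) * g z, ?_, ?_, ?_⟩
        · intro z; have := hg.1 z; linarith
        · intro z I u hu hI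
          exact dominates_interpolation (f := fun _ => 0) (hmemS ω) hcover le_rfl zero_le_one
            (Or.inl rfl) (fun _ => le_rfl) hg z I u hu hI
        · have h1 : Real.exp (1 / 4) ≤ 2 - Real.exp (-(1 / 2)) := by
            have := exp_sub_sq_le (s := 1 / 2) (by norm_num) le_rfl
            norm_num at this ⊢
            linarith
          have h2 : ∑ z, Real.exp (((1 - 0) ^ 2 + 0 * (0 : ℝ) + (1 - 0) * g z) / 4) =
              Real.exp (1 / 4) * ∑ z, Real.exp (g z / 4) := by
            rw [Finset.mul_sum]
            refine Finset.sum_congr rfl fun z _ => ?_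
            rw [← Real.exp_add]; congr 1; ring
          rw [h2]
          calc (B.card : ℝ) ^ 2 * (Real.exp (1 / 4) * ∑ z, Real.exp (g z / 4))
              = (B.card * Real.exp (1 / 4)) * (B.card * ∑ z, Real.exp (g z / 4)) := by ring
            _ ≤ (B.card * Real.exp (1 / 4)) * K := by gcongr
            _ ≤ (B.card * (2 - Real.exp (-(1 / 2)))) * K := by gcongr
            _ ≤ K * (2 * B.card - (S ω).card) := by nlinarith
    choose f hf0 hfI hfS using step
    refine ⟨fun x => f (x 0) (Fin.tail x), ⟨fun x => hf0 _ _, ?_⟩, ?_⟩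
    · intro y I u hu h
      refine hfI (y 0) (Fin.tail y) I u hu ?_
      simpa using h
    · rw [sum_pi_fin_succ]
      simp only [Fin.cons_zero, Fin.tail_cons]
      have hcardA : (A.card : ℝ) = ∑ ω, ((S ω).card : ℝ) := by
        have h := sum_pi_fin_succ (fun x : Fin (m + 1) → α => if x ∈ A then (1 : ℝ) else 0)
        simp only [Finset.sum_boole] at h
        simpa [hS] using h
      have h1 := Finset.sum_le_sum fun ω (_ : ω ∈ Finset.univ) => hfS ω
      rw [← Finset.mul_sum, ← Finset.mul_sum, Finset.sum_sub_distrib, ← hcardA] at h1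
      simp only [Finset.sum_const, Finset.card_univ, nsmul_eq_mul, ← hN] at h1
      set T := ∑ ω, ∑ z, Real.exp (f ω z / 4)
      -- After summing over the first coordinate, what remains is `a (2b - a) ≤ b²` with `a = |A|`
      -- and `b = N |B|`.
      have h2 : (B.card : ℝ) ^ 2 * (A.card * T) ≤ (B.card : ℝ) ^ 2 * ((N ^ (m + 1)) ^ 2) := by
        calc _ = A.card * ((B.card : ℝ) ^ 2 * T) := by ring
          _ ≤ A.card * (K * (N * (2 * B.card) - A.card)) := by gcongr
          _ = K * (A.card * (N * (2 * B.card) - A.card)) := by ring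
          _ ≤ K * ((N * B.card) ^ 2) := by
            gcongr; nlinarith [sq_nonneg (N * B.card - (A.card : ℝ))]
          _ = _ := by rw [hK]; ring
      exact le_of_mul_le_mul_left h2 (by positivity)

/-- Markov's inequality for `exp (ψ / 4)`: on `C` the certificates force `ψ ≥ u² / k`. -/
theorem card_mul_card_le_of_far {α : Type*} [Fintype α] [DecidableEq α] {m : ℕ}
    (A C : Finset (Fin m → α)) {u k : ℝ} (hu : 0 ≤ u) (hk : 0 < k)
    (hC : ∀ y ∈ C, ∃ I : Finset (Fin m), (I.card : ℝ) ≤ k ∧ ∀ x ∈ A, u ≤ diffCount I x y) :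
    (A.card : ℝ) * C.card ≤
      ((Fintype.card α : ℝ) ^ m) ^ 2 * Real.exp (-(u ^ 2 / (4 * k))) := by
  rcases A.eq_empty_or_nonempty with rfl | hA
  · simp only [Finset.card_empty, Nat.cast_zero, zero_mul]; positivity
  obtain ⟨ψ, hψ, h⟩ := exists_dominatesDist m A hA
  have h1 : ∀ y ∈ C, Real.exp (u ^ 2 / (4 * k)) ≤ Real.exp (ψ y / 4) := by
    intro y hy
    obtain ⟨I, hI, hx⟩ := hC y hy
    have h2 := hψ.2 y I u hu hx
    have h3 : u ^ 2 ≤ k * ψ y := h2.trans (mul_le_mul_of_nonneg_right hI (hψ.1 y))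
    rw [Real.exp_le_exp, div_le_div_iff₀ (by positivity) (by norm_num)]
    linarith
  have h2 : C.card * Real.exp (u ^ 2 / (4 * k)) ≤ ∑ y, Real.exp (ψ y / 4) := by
    rw [← nsmul_eq_mul]
    exact (Finset.card_nsmul_le_sum C _ _ h1).trans
      (Finset.sum_le_univ_sum_of_nonneg fun _ => (Real.exp_pos _).le)
  rw [Real.exp_neg, ← div_eq_mul_inv, le_div_iff₀ (Real.exp_pos _), mul_assoc]
  exact (mul_le_mul_of_nonneg_left h2 (Nat.cast_nonneg _)).trans h

/-! ### Bin loads and the variance of the number of heavy balls -/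

/-- The number of balls in the bin `a`. -/
def load {α : Type*} [DecidableEq α] {m : ℕ} (x : Fin m → α) (a : α) : ℕ :=
  (Finset.univ.filter fun k => x k = a).card

theorem load_cons {α : Type*} [DecidableEq α] {m : ℕ} (ω : α) (z : Fin m → α) (a : α) :
    load (Fin.cons ω z : Fin (m + 1) → α) a = (if ω = a then 1 else 0) + load z a := by
  unfold load
  rw [Fin.card_filter_univ_succ']
  simp

theorem sum_comp_ite_eq {α : Type*} [Fintype α] [DecidableEq α] (c : α) (F : ℕ → ℝ) :
    ∑ ω : α, F (if ω = c then 1 else 0) = F 1 + ((Fintype.card α : ℝ) - 1) * F 0 := by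
  rw [← Finset.add_sum_erase _ _ (Finset.mem_univ c), if_pos rfl]
  congr 1
  rw [Finset.sum_congr rfl (g := fun _ => F 0)
    (fun ω hω => by rw [if_neg (Finset.ne_of_mem_erase hω)]), Finset.sum_const,
    Finset.card_erase_of_mem (Finset.mem_univ c), nsmul_eq_mul, Finset.card_univ,
    Nat.cast_sub (Fintype.card_pos_iff.2 ⟨c⟩)]
  simp

/-- The loads of two bins are negatively correlated. -/
theorem sum_mul_load_le {α : Type*} [Fintype α] [DecidableEq α] {a b : α} (hab : a ≠ b) (m : ℕ) :
    ∀ g h : ℕ → ℝ, Monotone g → Monotone h →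
      (Fintype.card α : ℝ) ^ m * ∑ x : Fin m → α, g (load x a) * h (load x b) ≤
        (∑ x : Fin m → α, g (load x a)) * ∑ x : Fin m → α, h (load x b) := by
  have split2 : ∀ F : ℕ → ℕ → ℝ,
      ∑ ω : α, F (if ω = a then 1 else 0) (if ω = b then 1 else 0) =
      F 1 0 + F 0 1 + ((Fintype.card α : ℝ) - 2) * F 0 0 := by
    intro F
    have hpt : ∀ ω : α, F (if ω = a then 1 else 0) (if ω = b then 1 else 0) =
        F (if ω = a then 1 else 0) 0 + F 0 (if ω = b then 1 else 0) - F 0 0 := by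
      intro ω
      by_cases h1 : ω = a
      · have : ω ≠ b := fun h => hab (h1 ▸ h)
        simp [h1, hab]
      · simp [h1]
    rw [Finset.sum_congr rfl fun ω _ => hpt ω, Finset.sum_sub_distrib, Finset.sum_add_distrib,
      sum_comp_ite_eq a (fun k => F k 0), sum_comp_ite_eq b (fun k => F 0 k)]
    simp
    ring
  induction m with
  | zero => intro g h _ _; simp
  | succ m ih =>
    intro g h hg hh
    have hg' : Monotone fun k => g (1 + k) := fun _ _ hk => hg (by gcongr)
    have hh' : Monotone fun k => h (1 + k) := fun _ _ hk => hh (by gcongr)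
    simp only [sum_pi_fin_succ, load_cons]
    rw [split2 (fun p q => ∑ z : Fin m → α, g (p + load z a) * h (q + load z b)),
      sum_comp_ite_eq a (fun p => ∑ z : Fin m → α, g (p + load z a)),
      sum_comp_ite_eq b (fun p => ∑ z : Fin m → α, h (p + load z b))]
    simp only [zero_add]
    have e10 := ih (fun k => g (1 + k)) h hg' hh
    have e01 := ih g (fun k => h (1 + k)) hg hh'
    have e00 := ih g h hg hh
    have hGle : ∑ z : Fin m → α, g (load z a) ≤ ∑ z : Fin m → α, g (1 + load z a) :=
      Finset.sum_le_sum fun z _ => hg (by omega)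
    have hHle : ∑ z : Fin m → α, h (load z b) ≤ ∑ z : Fin m → α, h (1 + load z b) :=
      Finset.sum_le_sum fun z _ => hh (by omega)
    have hN : (2 : ℝ) ≤ Fintype.card α := by
      exact_mod_cast Fintype.one_lt_card_iff.2 ⟨a, b, hab⟩
    generalize (Fintype.card α : ℝ) = N at *
    have h2 := mul_le_mul_of_nonneg_left e00 (sub_nonneg.2 hN)
    have h3 : 0 ≤ N := by linarith
    have h4 := mul_le_mul_of_nonneg_left (add_le_add (add_le_add e10 e01) h2) h3
    -- Once the induction hypotheses are inserted, the two sides differ by exactly `(G' - G) (H' -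
    -- H)`, where the prime means one extra ball in the bin concerned.
    have h5 := mul_nonneg (sub_nonneg.2 hGle) (sub_nonneg.2 hHle)
    rw [pow_succ]
    linear_combination h4 + h5

/-- Size biasing: the factor `load x a` selects a ball of bin `a`; there are `m + 1` choices, and
the other `m` balls remain free. -/
theorem sum_load_mul {α : Type*} [Fintype α] [DecidableEq α] (a : α) (m : ℕ) :
    ∀ g : ℕ → ℝ, ∑ x : Fin (m + 1) → α, (load x a : ℝ) * g (load x a) =
      (m + 1) * ∑ z : Fin m → α, g (1 + load z a) := by
  induction m with
  | zero =>
    intro g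
    rw [sum_pi_fin_succ]
    simp only [load_cons]
    rw [sum_comp_ite_eq a (fun p => ∑ z : Fin 0 → α, ((p + load z a : ℕ) : ℝ) * g (p + load z a))]
    simp [load]
  | succ m ih =>
    intro g
    rw [sum_pi_fin_succ]
    simp only [load_cons]
    rw [sum_comp_ite_eq a
      (fun p => ∑ z : Fin (m + 1) → α, ((p + load z a : ℕ) : ℝ) * g (p + load z a))]
    have h1 := ih fun k => g (1 + k)
    have h2 := ih g
    have h3 : ∑ z : Fin (m + 1) → α, g (1 + load z a) =
        ∑ w : Fin m → α, g (1 + (1 + load w a)) +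
          ((Fintype.card α : ℝ) - 1) * ∑ w : Fin m → α, g (1 + load w a) := by
      rw [sum_pi_fin_succ]
      simp only [load_cons]
      rw [sum_comp_ite_eq a (fun p => ∑ z : Fin m → α, g (1 + (p + load z a)))]
      simp
    simp only [Nat.cast_add, Nat.cast_one, add_mul, one_mul, Finset.sum_add_distrib, zero_add,
      h1, h2] at h1 h2 h3 ⊢
    rw [h3]
    ring

theorem card_mul_sum_load_le {α : Type*} [Fintype α] [DecidableEq α] (a : α) (m : ℕ) {g : ℕ → ℝ}
    (hg : Monotone g) :
    (Fintype.card α : ℝ) * ∑ z : Fin m → α, g (load z a) ≤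
      ∑ x : Fin (m + 1) → α, g (load x a) := by
  rw [sum_pi_fin_succ, ← nsmul_eq_mul, ← Finset.card_univ, ← Finset.sum_const]
  refine Finset.sum_le_sum fun ω _ => Finset.sum_le_sum fun z _ => hg ?_
  rw [load_cons]
  omega

/-- The number of balls that a bin of load `k` contributes to the heavy balls. -/
noncomputable def heavyLoad (i k : ℕ) : ℝ := if i ≤ k then k else 0

theorem heavyLoad_nonneg (i k : ℕ) : 0 ≤ heavyLoad i k := by
  unfold heavyLoad; positivity

theorem heavyLoad_monotone (i : ℕ) : Monotone (heavyLoad i) := by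
  intro j k h
  unfold heavyLoad
  split_ifs with h1 h2
  · exact_mod_cast h
  · omega
  · positivity
  · rfl

/-- On a heavy bin `load² = load (load - i) + i load`. Size biasing the first term, then restoring
the removed ball, costs a factor `m / n ≤ 1/3` and gives `3T ≤ T + S`, so `T ≤ S / 2`. Truncated
subtraction makes `load - i` vanish on light bins. -/
theorem sum_heavyLoad_sq_le {α : Type*} [Fintype α] [DecidableEq α] (a : α) {m i : ℕ} (hi : 1 ≤ i)
    (hm : 3 * m ≤ Fintype.card α) :
    ∑ x : Fin m → α, heavyLoad i (load x a) ^ 2 ≤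
      2 * i * ∑ x : Fin m → α, heavyLoad i (load x a) := by
  cases m with
  | zero =>
    have h : ∀ x : Fin 0 → α, heavyLoad i (load x a) = 0 := by
      intro x; simp [load, heavyLoad]
    simp [h]
  | succ m =>
    set T := ∑ x : Fin (m + 1) → α, (load x a : ℝ) * ((load x a - i : ℕ) : ℝ) with hT
    set S := ∑ x : Fin (m + 1) → α, heavyLoad i (load x a) with hS
    have hmono : Monotone fun k : ℕ => ((1 + k - i : ℕ) : ℝ) := by
      intro j k h
      have : 1 + j - i ≤ 1 + k - i := by omega
      exact Nat.cast_le.2 this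
    have h1 : T = (m + 1) * ∑ z : Fin m → α, ((1 + load z a - i : ℕ) : ℝ) :=
      sum_load_mul a m fun k => ((k - i : ℕ) : ℝ)
    have h2 := card_mul_sum_load_le a m hmono
    have h3 : ∑ x : Fin (m + 1) → α, ((1 + load x a - i : ℕ) : ℝ) ≤ T + S := by
      rw [hT, hS, ← Finset.sum_add_distrib]
      refine Finset.sum_le_sum fun x _ => ?_
      unfold heavyLoad
      split_ifs with h
      · have h4 : 1 + load x a - i = (load x a - i) + 1 := by omega
        have h5 : (load x a - i) + 1 ≤ load x a * (load x a - i) + load x a := by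
          nlinarith [Nat.zero_le (load x a - i)]
        rw [h4]
        exact_mod_cast h5
      · have h4 : 1 + load x a - i = 0 := by omega
        rw [h4]; simp only [Nat.cast_zero]; positivity
    have h6 : ∑ x : Fin (m + 1) → α, heavyLoad i (load x a) ^ 2 = T + i * S := by
      rw [hT, hS, Finset.mul_sum, ← Finset.sum_add_distrib]
      refine Finset.sum_congr rfl fun x _ => ?_
      unfold heavyLoad
      split_ifs with h
      · push_cast [h]; ring
      · have h4 : load x a - i = 0 := by omega
        simp [h4]
    have h7 : 0 ≤ ∑ z : Fin m → α, ((1 + load z a - i : ℕ) : ℝ) := by positivity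
    have h8 : 3 * ((m : ℝ) + 1) ≤ Fintype.card α := by exact_mod_cast hm
    have h9 : 3 * T ≤ T + S := by
      rw [h1] at h3 ⊢
      nlinarith [mul_le_mul_of_nonneg_right h8 h7]
    have hS0 : 0 ≤ S := Finset.sum_nonneg fun x _ => heavyLoad_nonneg _ _
    have hi' : (1 : ℝ) ≤ i := by exact_mod_cast hi
    rw [h6]
    nlinarith

theorem heavyBalls_eq_sum {m n : ℕ} (i : ℕ) (x : Fin m → Fin n) :
    (heavyBalls i x : ℝ) = ∑ a, heavyLoad i (load x a) := by
  unfold heavyBalls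
  rw [Finset.card_eq_sum_card_fiberwise (f := x) (t := Finset.univ) (fun _ _ => Finset.mem_univ _)]
  push_cast
  refine Finset.sum_congr rfl fun a _ => ?_
  rw [Finset.filter_filter]
  unfold heavyLoad load
  split_ifs with h
  · congr 2
    ext j
    simp only [Finset.mem_filter, Finset.mem_univ, true_and]
    constructor
    · exact fun h' => h'.2
    · intro h'; exact ⟨by rw [h']; exact h, h'⟩
  · rw [Nat.cast_eq_zero, Finset.card_eq_zero, Finset.filter_eq_empty_iff]
    rintro j - ⟨h1, h2⟩
    rw [h2] at h1
    exact h h1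

/-- The variance bound for the number of heavy balls, in counting form. -/
theorem sum_heavyBalls_sq_le {m n i : ℕ} (hi : 1 ≤ i) (hm : 3 * m ≤ n) :
    (n : ℝ) ^ m * ∑ x : Fin m → Fin n, (heavyBalls i x : ℝ) ^ 2 ≤
      (n : ℝ) ^ m * (2 * i * ∑ x : Fin m → Fin n, (heavyBalls i x : ℝ)) +
        (∑ x : Fin m → Fin n, (heavyBalls i x : ℝ)) ^ 2 := by
  set p : Fin n → ℝ := fun a => ∑ x : Fin m → Fin n, heavyLoad i (load x a) with hp
  have hL : ∑ x : Fin m → Fin n, (heavyBalls i x : ℝ) = ∑ a, p a := by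
    simp only [heavyBalls_eq_sum, hp]
    exact Finset.sum_comm
  have hp0 : ∀ a, 0 ≤ p a := fun a => Finset.sum_nonneg fun x _ => heavyLoad_nonneg _ _
  have hL2 : ∑ x : Fin m → Fin n, (heavyBalls i x : ℝ) ^ 2 =
      ∑ a, ∑ b, ∑ x : Fin m → Fin n, heavyLoad i (load x a) * heavyLoad i (load x b) := by
    simp only [heavyBalls_eq_sum, sq, Finset.sum_mul_sum]
    rw [Finset.sum_comm]
    exact Finset.sum_congr rfl fun a _ => Finset.sum_comm
  rw [hL, hL2, sq, Finset.sum_mul_sum, Finset.mul_sum, Finset.mul_sum, Finset.mul_sum,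
    ← Finset.sum_add_distrib]
  refine Finset.sum_le_sum fun a _ => ?_
  rw [Finset.mul_sum, ← Finset.add_sum_erase _ _ (Finset.mem_univ a)]
  -- The diagonal term is the one-bin second moment; the other terms use negative correlation.
  refine add_le_add ?_ ?_
  · refine mul_le_mul_of_nonneg_left ?_ (by positivity)
    simp only [← sq]
    exact sum_heavyLoad_sq_le a hi (by simpa using hm)
  · calc _ ≤ ∑ b ∈ Finset.univ.erase a, p a * p b := by
          refine Finset.sum_le_sum fun b hb => ?_
          have h := sum_mul_load_le (Finset.ne_of_mem_erase hb).symm m _ _ (heavyLoad_monotone i)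
            (heavyLoad_monotone i)
          simpa using h
      _ ≤ _ := Finset.sum_le_sum_of_subset_of_nonneg (Finset.erase_subset _ _)
          fun b _ _ => mul_nonneg (hp0 a) (hp0 b)

/-! ### Certificates and the two-sided tail product -/

theorem agree_le_heavyBalls {m n i : ℕ} {x y : Fin m → Fin n} {I : Finset (Fin m)}
    (hI : ∀ j ∈ I, i ≤ (I.filter fun k => y k = y j).card) (hxy : ∀ j ∈ I, x j = y j) :
    I.card ≤ heavyBalls i x := by
  refine Finset.card_le_card fun j hj => ?_
  simp only [Finset.mem_filter, Finset.mem_univ, true_and]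
  refine (hI j hj).trans (Finset.card_le_card fun k hk => ?_)
  simp only [Finset.mem_filter, Finset.mem_univ, true_and] at hk ⊢
  rw [hxy k hk.1, hxy j hj, hk.2]

/-- A lower bound on the number of heavy balls is certified by few balls. -/
theorem exists_certificate {m n i : ℕ} (hi : 1 ≤ i) (y : Fin m → Fin n) {s : ℝ}
    (hs0 : 0 ≤ s) (hs : s ≤ heavyBalls i y) :
    ∃ I : Finset (Fin m), s ≤ I.card ∧ (I.card : ℝ) ≤ s + i ∧
      ∀ j ∈ I, i ≤ (I.filter fun k => y k = y j).card := by
  classical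
  set P : Finset (Fin m) → Prop := fun I => s ≤ I.card ∧
    ∀ j ∈ I, i ≤ (I.filter fun k => y k = y j).card with hP
  have hex : (Finset.univ.filter P).Nonempty := by
    refine ⟨Finset.univ.filter fun j : Fin m =>
      i ≤ (Finset.univ.filter fun k : Fin m => y k = y j).card, ?_⟩
    simp only [Finset.mem_filter, Finset.mem_univ, true_and, hP]
    refine ⟨hs, fun j hj => hj.trans (Finset.card_le_card fun k hk => ?_)⟩
    simp only [Finset.mem_filter, Finset.mem_univ, true_and] at hk ⊢
    exact ⟨by rw [hk]; exact hj, hk⟩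
  obtain ⟨I, hI, hmin⟩ := Finset.exists_min_image _ Finset.card hex
  simp only [Finset.mem_filter, Finset.mem_univ, true_and] at hI hmin
  refine ⟨I, hI.1, ?_, hI.2⟩
  by_contra! hlt
  have hi' : (1 : ℝ) ≤ i := by exact_mod_cast hi
  have hIpos : (0 : ℝ) < I.card := by linarith
  obtain ⟨j, hj⟩ : I.Nonempty := Finset.card_pos.1 (by exact_mod_cast hIpos)
  set B := I.filter fun k => y k = y j with hB
  have hjB : j ∈ B := by simp [hB, hj]
  have hBI : B ⊆ I := Finset.filter_subset _ _
  -- A certificate larger than `s + i` is not minimal: a bin with exactly `i` chosen balls can be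
  -- dropped whole, and a fuller bin can lose one ball.
  rcases (hI.2 j hj).eq_or_lt with heq | hgt
  · have hc : (I \ B).card = I.card - B.card := Finset.card_sdiff_of_subset hBI
    have hle := Finset.card_le_card hBI
    have hc' : ((I \ B).card : ℝ) = I.card - i := by
      rw [hc, Nat.cast_sub hle, ← heq]
    have h := hmin (I \ B) ⟨by rw [hc']; linarith, fun k hk => ?_⟩
    · have := Finset.card_pos.2 ⟨j, hjB⟩
      omega
    · have hk' := Finset.mem_sdiff.1 hk
      refine (hI.2 k hk'.1).trans (Finset.card_le_card fun l hl => ?_)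
      simp only [Finset.mem_filter, Finset.mem_sdiff, hB] at hl hk' ⊢
      refine ⟨⟨hl.1, fun h => hk'.2 ⟨hk'.1, by rw [← hl.2, h.2]⟩⟩, hl.2⟩
  · have hc : ((I.erase j).card : ℝ) = I.card - 1 := by
      rw [Finset.card_erase_of_mem hj, Nat.cast_sub (Finset.card_pos.2 ⟨j, hj⟩)]
      simp
    have h := hmin (I.erase j) ⟨by rw [hc]; linarith, fun k hk => ?_⟩
    · have := Finset.card_erase_lt_of_mem hj
      omega
    · have hk' := Finset.mem_erase.1 hk
      by_cases hkj : y k = y j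
      · have : (I.erase j).filter (fun l => y l = y k) = B.erase j := by
          ext l
          simp only [Finset.mem_filter, Finset.mem_erase, hB, hkj]
          tauto
        rw [this, Finset.card_erase_of_mem hjB]
        exact Nat.le_sub_one_of_lt hgt
      · refine (hI.2 k hk'.2).trans (Finset.card_le_card fun l hl => ?_)
        simp only [Finset.mem_filter, Finset.mem_erase] at hl ⊢
        exact ⟨⟨fun h => hkj (by rw [← hl.2, h]), hl.1⟩, hl.2⟩

/-- Only the moved ball and the occupants of its new bin can become heavy, and the latter only if
they numbered at most `i - 1`. -/
theorem heavyBalls_update_le {m n i : ℕ} (hi : 1 ≤ i) (x : Fin m → Fin n) (j : Fin m)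
    (b : Fin n) : heavyBalls i (Function.update x j b) ≤ heavyBalls i x + i := by
  classical
  set y := Function.update x j b with hy
  set X := Finset.univ.filter fun j : Fin m =>
    i ≤ (Finset.univ.filter fun k : Fin m => x k = x j).card with hX
  set Y := Finset.univ.filter fun j : Fin m =>
    i ≤ (Finset.univ.filter fun k : Fin m => y k = y j).card with hY
  set C := Finset.univ.filter fun k : Fin m => x k = b with hC
  have hne : ∀ k, k ≠ j → y k = x k := fun k hk => by simp [hy, hk]
  have hsub : Y \ X ⊆ insert j (if C.card < i then C else ∅) := by
    intro k hk
    rw [Finset.mem_insert]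
    by_cases hkj : k = j
    · exact Or.inl hkj
    right
    simp only [Finset.mem_sdiff, hX, hY, Finset.mem_filter, Finset.mem_univ, true_and, not_le,
      hne k hkj] at hk
    have hxb : x k = b := by
      by_contra hxb
      have : (Finset.univ.filter fun l : Fin m => y l = x k).card ≤
          (Finset.univ.filter fun l : Fin m => x l = x k).card := by
        refine Finset.card_le_card fun l hl => ?_
        simp only [Finset.mem_filter, Finset.mem_univ, true_and] at hl ⊢
        by_cases hlj : l = j
        · subst hlj
          exact absurd (by simpa [hy] using hl.symm) hxb
        · rw [← hne l hlj, hl]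
      omega
    have hCi : C.card < i := by rw [hC, ← hxb]; exact hk.2
    rw [if_pos hCi]
    simp [hC, hxb]
  have hcard : (Y \ X).card ≤ i := by
    refine (Finset.card_le_card hsub).trans ((Finset.card_insert_le _ _).trans ?_)
    split_ifs with h
    · omega
    · simpa using hi
  have h1 : Y.card ≤ (Y \ X).card + X.card := Finset.card_le_card_sdiff_add_card
  change Y.card ≤ X.card + i
  omega

theorem heavyBalls_piecewise_le {m n i : ℕ} (hi : 1 ≤ i) (x y : Fin m → Fin n)
    (D : Finset (Fin m)) : heavyBalls i (D.piecewise y x) ≤ heavyBalls i x + i * D.card := by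
  classical
  induction D using Finset.induction_on with
  | empty => simp
  | insert j D hj ih =>
    rw [Finset.piecewise_insert, Finset.card_insert_of_notMem hj]
    have := heavyBalls_update_le hi (D.piecewise y x) j (y j)
    rw [mul_add]
    omega

/-- Overwriting `x` by `y` where they differ on `I` makes every ball of `I` heavy, at a cost of at
most `i` per change. -/
theorem le_mul_diffCount {m n i : ℕ} (hi : 1 ≤ i) {x y : Fin m → Fin n} {I : Finset (Fin m)}
    (hI : ∀ j ∈ I, i ≤ (I.filter fun k => y k = y j).card) :
    I.card ≤ heavyBalls i x + i * diffCount I x y := by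
  refine le_trans ?_ (heavyBalls_piecewise_le hi x y (Finset.univ.filter fun j => j ∈ I ∧ x j ≠ y j))
  refine agree_le_heavyBalls hI fun j hj => ?_
  by_cases h : x j = y j
  · rw [Finset.piecewise]; split_ifs <;> simp [h]
  · rw [Finset.piecewise_eq_of_mem]; simp [hj, h]

theorem card_low_mul_card_high_le {m n i : ℕ} (hi : 1 ≤ i) {a t : ℝ} (ha : 0 ≤ a) (ht : 0 ≤ t) :
    ((Finset.univ.filter fun x : Fin m → Fin n => (heavyBalls i x : ℝ) ≤ a).card : ℝ) *
      (Finset.univ.filter fun x : Fin m → Fin n => a + t ≤ (heavyBalls i x : ℝ)).card ≤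
      ((n : ℝ) ^ m) ^ 2 * Real.exp (-(t ^ 2 / (4 * i ^ 2 * (a + t + i)))) := by
  have hi' : (0 : ℝ) < i := by exact_mod_cast hi
  have h := card_mul_card_le_of_far
    (Finset.univ.filter fun x : Fin m → Fin n => (heavyBalls i x : ℝ) ≤ a)
    (Finset.univ.filter fun x : Fin m → Fin n => a + t ≤ (heavyBalls i x : ℝ))
    (u := t / i) (k := a + t + i) (by positivity) (by positivity) ?_
  · rw [Fintype.card_fin] at h
    refine h.trans (le_of_eq ?_)
    congr 3
    field_simp
  · intro y hy
    simp only [Finset.mem_filter, Finset.mem_univ, true_and] at hy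
    obtain ⟨I, h1, h2, h3⟩ := exists_certificate hi y (by positivity) hy
    refine ⟨I, h2, fun x hx => ?_⟩
    simp only [Finset.mem_filter, Finset.mem_univ, true_and] at hx
    have h4 : (I.card : ℝ) ≤ heavyBalls i x + i * diffCount I x y := by
      exact_mod_cast le_mul_diffCount hi h3
    rw [div_le_iff₀ hi']
    linarith

/-! ### The median, and the passage from counting to probability -/

/-- On a finite probability space the median is attained, and it is a value of the variable. -/
theorem rvMedian_spec {Ω : Type*} [Finite Ω] [MeasurableSpace Ω] [MeasurableSingletonClass Ω]
    (P : Measure Ω) [IsProbabilityMeasure P] (f : Ω → ℝ) :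
    (∃ ω, rvMedian P f = f ω) ∧ 1 / 2 ≤ P.real {ω | f ω ≤ rvMedian P f} ∧
      1 / 2 ≤ P.real {ω | rvMedian P f ≤ f ω} := by
  classical
  have : Fintype Ω := Fintype.ofFinite Ω
  have hne : Nonempty Ω := nonempty_of_isProbabilityMeasure P
  have hms : ∀ s : Set Ω, MeasurableSet s := fun s => s.toFinite.measurableSet
  have hle : ∀ v, P.real {ω | f ω ≤ v} = 1 - P.real {ω | v < f ω} := by
    intro v
    rw [← probReal_compl_eq_one_sub (hms _)]
    congr 1; ext ω; simp
  have hge : ∀ v, P.real {ω | v ≤ f ω} = 1 - P.real {ω | f ω < v} := by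
    intro v
    rw [← probReal_compl_eq_one_sub (hms _)]
    congr 1; ext ω; simp
  have hmax : ∀ s : Set Ω, 1 / 2 ≤ P.real s →
      ∃ ω ∈ s, ∀ ω' ∈ s, f ω' ≤ f ω := by
    intro s hs
    have hsne : s.Nonempty := by
      by_contra h
      rw [Set.not_nonempty_iff_eq_empty] at h
      rw [h] at hs
      norm_num at hs
    exact Set.exists_max_image s f s.toFinite hsne
  -- The median is the least value of `f` whose lower tail has mass at least 1/2.
  set T : Set Ω := {x | 1 / 2 ≤ P.real {ω | f ω ≤ f x}} with hT
  have hTne : T.Nonempty := by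
    obtain ⟨x, -, hx⟩ := hmax Set.univ (by simp; norm_num)
    refine ⟨x, ?_⟩
    have : {ω | f ω ≤ f x} = Set.univ := Set.eq_univ_of_forall fun ω => hx ω trivial
    simp only [hT, Set.mem_ofPred_eq, this]
    simp; norm_num
  obtain ⟨x₀, hx₀, hmin⟩ := Set.exists_min_image T f T.toFinite hTne
  have hx₀' : 1 / 2 ≤ P.real {ω | f ω ≤ f x₀} := hx₀
  have hlt : P.real {ω | f ω < f x₀} ≤ 1 / 2 := by
    by_contra! hc
    obtain ⟨x₁, h1, h2⟩ := hmax _ hc.le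
    have h3 : x₁ ∈ T := by
      refine hc.le.trans (measureReal_mono fun ω hω => h2 ω hω)
    exact absurd (hmin x₁ h3) (not_le.2 h1)
  have hleast : IsLeast {v : ℝ | P.real {ω | f ω < v} ≤ 1 / 2 ∧ P.real {ω | v < f ω} ≤ 1 / 2}
      (f x₀) := by
    refine ⟨⟨hlt, by linarith [hle (f x₀)]⟩, fun v hv => ?_⟩
    have h0 : 1 / 2 ≤ P.real {ω | f ω ≤ v} := by linarith [hle v, hv.2]
    obtain ⟨x₁, h1, h2⟩ := hmax _ h0
    have h3 : x₁ ∈ T := h0.trans (measureReal_mono fun ω hω => h2 ω hω)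
    exact (hmin x₁ h3).trans h1
  have hM : rvMedian P f = f x₀ := hleast.csInf_eq
  rw [hM]
  exact ⟨⟨x₀, rfl⟩, hx₀', by linarith [hge (f x₀)]⟩

instance (m n : ℕ) [NeZero n] : IsProbabilityMeasure (ballsIntoBins m n) := by
  have : IsProbabilityMeasure (uniformOn (Set.univ : Set (Fin n))) :=
    isProbabilityMeasure_uniformOn Set.finite_univ Set.univ_nonempty
  unfold ballsIntoBins
  infer_instance

theorem ballsIntoBins_real_singleton (m n : ℕ) [NeZero n] (x : Fin m → Fin n) :
    (ballsIntoBins m n).real {x} = 1 / (n : ℝ) ^ m := by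
  have : IsProbabilityMeasure (uniformOn (Set.univ : Set (Fin n))) :=
    isProbabilityMeasure_uniformOn Set.finite_univ Set.univ_nonempty
  rw [measureReal_def, ballsIntoBins, Measure.pi_singleton]
  simp [uniformOn_univ]

theorem ballsIntoBins_real (m n : ℕ) [NeZero n] (p : (Fin m → Fin n) → Prop) [DecidablePred p] :
    (ballsIntoBins m n).real {x | p x} = (Finset.univ.filter p).card / (n : ℝ) ^ m := by
  have h := sum_measureReal_singleton (μ := ballsIntoBins m n) (Finset.univ.filter p)
  simp only [ballsIntoBins_real_singleton, Finset.sum_const, nsmul_eq_mul, Finset.coe_filter,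
    Finset.mem_univ, true_and] at h
  rw [← h]; ring

theorem heavyMean_eq (m n i : ℕ) [NeZero n] :
    heavyMean m n i = (∑ x : Fin m → Fin n, (heavyBalls i x : ℝ)) / (n : ℝ) ^ m := by
  unfold heavyMean
  rw [integral_fintype (Integrable.of_finite)]
  simp only [ballsIntoBins_real_singleton, smul_eq_mul, ← Finset.mul_sum, heavyBallsRV]
  ring

/-- Chebyshev's inequality for the number of heavy balls. -/
theorem heavyBalls_chebyshev {m n i : ℕ} [NeZero n] (hi : 1 ≤ i) (hm : 3 * m ≤ n) {d : ℝ}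
    (hd : 0 ≤ d) {p : (Fin m → Fin n) → Prop}
    (hp : ∀ x, p x → d ≤ |heavyBallsRV m n i x - heavyMean m n i|) :
    (ballsIntoBins m n).real {x | p x} * d ^ 2 ≤ 2 * i * heavyMean m n i := by
  classical
  have hn : (0 : ℝ) < (n : ℝ) ^ m := by
    have : (0 : ℝ) < n := by exact_mod_cast Nat.pos_of_ne_zero (NeZero.ne n)
    positivity
  set N : ℝ := (n : ℝ) ^ m with hN
  set E := heavyMean m n i with hE
  have hES : ∑ x : Fin m → Fin n, (heavyBalls i x : ℝ) = N * E := by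
    rw [hE, heavyMean_eq, ← hN, mul_div_cancel₀ _ hn.ne']
  have hcardN : ((Finset.univ : Finset (Fin m → Fin n)).card : ℝ) = N := by simp [hN]
  have h1 := sum_heavyBalls_sq_le (m := m) (n := n) hi hm
  rw [← hN, hES] at h1
  have h2 : ∑ x : Fin m → Fin n, ((heavyBalls i x : ℝ) - E) ^ 2 =
      ∑ x : Fin m → Fin n, (heavyBalls i x : ℝ) ^ 2 - N * E ^ 2 := by
    simp only [sub_sq, Finset.sum_add_distrib, Finset.sum_sub_distrib, Finset.sum_const,
      nsmul_eq_mul, hcardN, ← Finset.sum_mul, ← Finset.mul_sum, hES]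
    ring
  have h3 : ∑ x : Fin m → Fin n, ((heavyBalls i x : ℝ) - E) ^ 2 ≤ N * (2 * i * E) := by
    rw [h2]
    have : N * ∑ x : Fin m → Fin n, (heavyBalls i x : ℝ) ^ 2 ≤
        N * (2 * i * (N * E) + N * E ^ 2) := by linarith
    linarith [le_of_mul_le_mul_left this hn]
  have h4 : ((Finset.univ.filter p).card : ℝ) * d ^ 2 ≤
      ∑ x : Fin m → Fin n, ((heavyBalls i x : ℝ) - E) ^ 2 := by
    rw [← nsmul_eq_mul]
    refine (Finset.card_nsmul_le_sum _ (fun x : Fin m → Fin n => ((heavyBalls i x : ℝ) - E) ^ 2) _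
      fun x hx => ?_).trans (Finset.sum_le_univ_sum_of_nonneg fun _ => sq_nonneg _)
    rw [← sq_abs ((heavyBalls i x : ℝ) - E)]
    have := hp x (Finset.mem_filter.1 hx).2
    simp only [heavyBallsRV] at this
    gcongr
  rw [ballsIntoBins_real, div_mul_eq_mul_div, div_le_iff₀ hn]
  linarith

theorem heavyBalls_low_mul_high_le {m n i : ℕ} [NeZero n] (hi : 1 ≤ i) {a t : ℝ} (ha : 0 ≤ a)
    (ht : 0 ≤ t) :
    (ballsIntoBins m n).real {x | heavyBallsRV m n i x ≤ a} *
      (ballsIntoBins m n).real {x | a + t ≤ heavyBallsRV m n i x} ≤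
      Real.exp (-(t ^ 2 / (4 * i ^ 2 * (a + t + i)))) := by
  classical
  have hn : (0 : ℝ) < (n : ℝ) ^ m := by
    have : (0 : ℝ) < n := by exact_mod_cast Nat.pos_of_ne_zero (NeZero.ne n)
    positivity
  have h := card_low_mul_card_high_le (m := m) (n := n) hi ha ht
  rw [ballsIntoBins_real, ballsIntoBins_real, div_mul_div_comm, div_le_iff₀ (by positivity)]
  simp only [heavyBallsRV]
  refine (h.trans (le_of_eq (by ring)))

/-! ### Median against mean -/

theorem le_heavyBalls_of_pos {m n i : ℕ} {x : Fin m → Fin n} (h : 0 < heavyBalls i x) :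
    i ≤ heavyBalls i x := by
  obtain ⟨j, hj⟩ := Finset.card_pos.1 h
  have hj' := (Finset.mem_filter.1 hj).2
  refine hj'.trans (Finset.card_le_card fun k hk => ?_)
  simp only [Finset.mem_filter, Finset.mem_univ, true_and] at hk ⊢
  rw [hk]; exact hj'

/-- On the side of the median away from the mean, of mass at least 1/2, every deviation from the
mean is at least `|M - E|`; Chebyshev applies there. -/
theorem sq_median_sub_mean_le {m n i : ℕ} [NeZero n] (hi : 1 ≤ i) (hm : 3 * m ≤ n) :
    (heavyMedian m n i - heavyMean m n i) ^ 2 ≤ 4 * i * heavyMean m n i := by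
  obtain ⟨-, hlo, hhi⟩ := rvMedian_spec (ballsIntoBins m n) (heavyBallsRV m n i)
  change 1 / 2 ≤ (ballsIntoBins m n).real {x | heavyBallsRV m n i x ≤ heavyMedian m n i} at hlo
  change 1 / 2 ≤ (ballsIntoBins m n).real {x | heavyMedian m n i ≤ heavyBallsRV m n i x} at hhi
  set M := heavyMedian m n i
  set E := heavyMean m n i
  have key : 1 / 2 * |M - E| ^ 2 ≤ 2 * i * E := by
    rcases le_total M E with h | h
    · refine le_trans (mul_le_mul_of_nonneg_right hlo (sq_nonneg _))
        (heavyBalls_chebyshev hi hm (abs_nonneg _) fun x hx => ?_)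
      rw [abs_of_nonpos (sub_nonpos.2 h), abs_of_nonpos] <;> simp only [M, E] at * <;> linarith
    · refine le_trans (mul_le_mul_of_nonneg_right hhi (sq_nonneg _))
        (heavyBalls_chebyshev hi hm (abs_nonneg _) fun x hx => ?_)
      rw [abs_of_nonneg (sub_nonneg.2 h), abs_of_nonneg] <;> simp only [M, E] at * <;> linarith
  rw [sq_abs] at key
  linarith

/-- The median is a value of `L_i`, and positive values are at least `i`. Hence `(M - E)² ≤ 4ME`, so
`E ≤ (3 + 2√2) M`. -/
theorem heavyMean_le_of_median_pos {m n i : ℕ} [NeZero n] (hi : 1 ≤ i) (hm : 3 * m ≤ n)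
    (hM : 0 < heavyMedian m n i) :
    (i : ℝ) ≤ heavyMedian m n i ∧ heavyMean m n i ≤ 6 * heavyMedian m n i := by
  have hiM : (i : ℝ) ≤ heavyMedian m n i := by
    obtain ⟨⟨x, hx⟩, -⟩ := rvMedian_spec (ballsIntoBins m n) (heavyBallsRV m n i)
    change heavyMedian m n i = _ at hx
    rw [hx] at hM ⊢
    exact Nat.cast_le.2 (le_heavyBalls_of_pos (Nat.cast_pos.1 hM))
  refine ⟨hiM, ?_⟩
  have h := sq_median_sub_mean_le (i := i) hi hm
  have hi' : (0 : ℝ) < i := by exact_mod_cast hi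
  by_contra! hc
  nlinarith

theorem abs_median_sub_mean_le {m n i : ℕ} [NeZero n] (hi : 1 ≤ i) (hm : 3 * m ≤ n)
    (hM : 0 < heavyMedian m n i) :
    |heavyMedian m n i - heavyMean m n i| ≤ 7 * i * √(heavyMedian m n i) := by
  have h := sq_median_sub_mean_le (i := i) hi hm
  have hE := (heavyMean_le_of_median_pos hi hm hM).2
  have hi' : (1 : ℝ) ≤ i := by exact_mod_cast hi
  apply abs_le_of_sq_le_sq _ (by positivity)
  rw [mul_pow, Real.sq_sqrt hM.le]
  nlinarith [mul_le_mul_of_nonneg_right hi' (mul_nonneg (zero_le_one.trans hi') hM.le),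
    mul_le_mul_of_nonneg_left hE (zero_le_one.trans hi')]

/-! ### Concentration and conclusion -/

/-- Adds the two tails, each doubled by division by the median's mass 1/2. This is where `m^c ≥ 4`
gives the constant 1 in front of `m^{-c}`. -/
theorem two_mul_exp_add_two_mul_exp_le {K : ℝ} (hK : 4 ≤ Real.exp K) :
    2 * Real.exp (-(7 / 4 * K)) + 2 * Real.exp (-(3 * K)) ≤ Real.exp (-K) := by
  set w := Real.exp (-(K / 4)) with hw
  have hw0 : 0 < w := Real.exp_pos _
  have h1 : Real.exp (-(7 / 4 * K)) = w ^ 7 := by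
    rw [hw, ← Real.exp_nat_mul]; congr 1; push_cast; ring
  have h2 : Real.exp (-(3 * K)) = w ^ 12 := by
    rw [hw, ← Real.exp_nat_mul]; congr 1; push_cast; ring
  have h3 : Real.exp (-K) = w ^ 4 := by
    rw [hw, ← Real.exp_nat_mul]; congr 1; push_cast; ring
  have h4 : w ^ 4 ≤ 1 / 4 := by
    rw [← h3, Real.exp_neg, ← one_div]
    exact one_div_le_one_div_of_le (by norm_num) hK
  have h5 : w ^ 2 ≤ 1 / 2 := by nlinarith [sq_nonneg w]
  have h6 : w ≤ 71 / 100 := by nlinarith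
  have h7 : w ^ 3 ≤ 71 / 200 := by nlinarith
  have h8 : w ^ 8 ≤ 1 / 16 := by nlinarith [pow_nonneg hw0.le 4]
  have h9 : 2 * w ^ 3 + 2 * w ^ 8 ≤ 1 := by linarith
  rw [h1, h2, h3]
  nlinarith [mul_le_mul_of_nonneg_left h9 (pow_nonneg hw0.le 4)]

/-- Concentration of the number of heavy balls around the median. -/
theorem heavyBalls_concentration {m n i : ℕ} [NeZero n] (hi : 1 ≤ i) {K : ℝ}
    (hK : 4 ≤ Real.exp K) (hM : 16 * (i : ℝ) ^ 2 * K ≤ heavyMedian m n i) :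
    (ballsIntoBins m n).real {x | 4 * (i : ℝ) * √(K * heavyMedian m n i) ≤
      |heavyBallsRV m n i x - heavyMedian m n i|} ≤ Real.exp (-K) := by
  obtain ⟨-, hlo, hhi⟩ := rvMedian_spec (ballsIntoBins m n) (heavyBallsRV m n i)
  change 1 / 2 ≤ (ballsIntoBins m n).real {x | heavyBallsRV m n i x ≤ heavyMedian m n i} at hlo
  change 1 / 2 ≤ (ballsIntoBins m n).real {x | heavyMedian m n i ≤ heavyBallsRV m n i x} at hhi
  set M := heavyMedian m n i
  set t := 4 * (i : ℝ) * √(K * M) with ht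
  have hi' : (1 : ℝ) ≤ i := by exact_mod_cast hi
  have hK1 : 1 ≤ K := by
    by_contra! h
    have := Real.exp_lt_exp.2 h
    linarith [Real.exp_one_lt_d9]
  have hiM : 16 * (i : ℝ) ≤ M := by nlinarith
  have hM0 : 0 < M := by linarith
  have ht0 : 0 ≤ t := by positivity
  have ht2 : t ^ 2 = 16 * i ^ 2 * K * M := by
    rw [ht, mul_pow, Real.sq_sqrt (by positivity)]; ring
  have htM : t ≤ M := by
    refine le_of_sq_le_sq ?_ hM0.le
    rw [ht2, sq M]
    exact mul_le_mul_of_nonneg_right hM hM0.le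
  have hup := heavyBalls_low_mul_high_le (m := m) (n := n) hi hM0.le ht0
  have hdown := heavyBalls_low_mul_high_le (m := m) (n := n) hi (sub_nonneg.2 htM) ht0
  rw [sub_add_cancel] at hdown
  -- The exponent is `4KM / (M + t + i)`. Since `t ≤ M` and `i ≤ M / 16`, it is at least `7K/4`; in
  -- the lower tail `t` is absent from the denominator and `3K` is available.
  have hup2 : Real.exp (-(t ^ 2 / (4 * i ^ 2 * (M + t + i)))) ≤ Real.exp (-(7 / 4 * K)) := by
    rw [Real.exp_le_exp, neg_le_neg_iff, le_div_iff₀ (by positivity), ht2]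
    have : 7 / 4 * (M + t + i) ≤ 4 * M := by linarith
    nlinarith [mul_le_mul_of_nonneg_left this (by positivity : 0 ≤ 4 * (i : ℝ) ^ 2 * K)]
  have hdown2 : Real.exp (-(t ^ 2 / (4 * i ^ 2 * (M + i)))) ≤ Real.exp (-(3 * K)) := by
    rw [Real.exp_le_exp, neg_le_neg_iff, le_div_iff₀ (by positivity), ht2]
    have : 3 * (M + i) ≤ 4 * M := by linarith
    nlinarith [mul_le_mul_of_nonneg_left this (by positivity : 0 ≤ 4 * (i : ℝ) ^ 2 * K)]
  set U := (ballsIntoBins m n).real {x | M + t ≤ heavyBallsRV m n i x} with hU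
  set D := (ballsIntoBins m n).real {x | heavyBallsRV m n i x ≤ M - t} with hD
  have hU0 : 0 ≤ U := measureReal_nonneg
  have hD0 : 0 ≤ D := measureReal_nonneg
  have hU1 : U ≤ 2 * Real.exp (-(7 / 4 * K)) := by
    nlinarith [mul_le_mul_of_nonneg_right hlo hU0]
  have hD1 : D ≤ 2 * Real.exp (-(3 * K)) := by
    nlinarith [mul_le_mul_of_nonneg_left hhi hD0]
  have hsub : {x | t ≤ |heavyBallsRV m n i x - M|} ⊆
      {x | M + t ≤ heavyBallsRV m n i x} ∪ {x | heavyBallsRV m n i x ≤ M - t} := by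
    intro x hx
    rcases le_abs.1 (show t ≤ |heavyBallsRV m n i x - M| from hx) with h | h
    · left; change M + t ≤ heavyBallsRV m n i x; linarith
    · right; change heavyBallsRV m n i x ≤ M - t; linarith
  calc _ ≤ U + D := (measureReal_mono hsub).trans (measureReal_union_le _ _)
    _ ≤ _ := by linarith [two_mul_exp_add_two_mul_exp_le hK]

theorem heavyMean_one_eq_zero {n i : ℕ} [NeZero n] (hM : heavyMedian 1 n i ≤ 0) :
    heavyMedian 1 n i = 0 ∧ heavyMean 1 n i = 0 := by
  have hval : ∀ x : Fin 1 → Fin n, heavyBalls i x = if i ≤ 1 then 1 else 0 := by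
    intro x
    unfold heavyBalls
    by_cases h : i ≤ 1 <;> simp [Finset.filter_true_of_mem, h, Subsingleton.elim _ (0 : Fin 1)]
  obtain ⟨⟨x, hx⟩, -⟩ := rvMedian_spec (ballsIntoBins 1 n) (heavyBallsRV 1 n i)
  change heavyMedian 1 n i = _ at hx
  rw [heavyBallsRV, hval] at hx
  by_cases h : i ≤ 1
  · simp only [h, if_true, Nat.cast_one] at hx; linarith
  · refine ⟨by simpa [h] using hx, ?_⟩
    rw [heavyMean_eq]
    simp [hval, h]

theorem mainTheorem8 :
    ∃ c' : ℝ, 0 < c' ∧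
      ∀ (m n i : ℕ) (c : ℝ), 1 ≤ m → 3 * m ≤ n → 1 ≤ i → 0 < c →
        16 * (i : ℝ) ^ 2 * c * Real.log m ≤ heavyMedian m n i →
        (4 ≤ (m : ℝ) ^ c →
          (ballsIntoBins m n).real
              {x | 4 * (i : ℝ) * √(c * heavyMedian m n i * Real.log m) ≤
                |heavyBallsRV m n i x - heavyMedian m n i|}
            ≤ 1 / (m : ℝ) ^ c) ∧
        |heavyMedian m n i - heavyMean m n i| ≤ c' * i * √(heavyMedian m n i) ∧
        (ballsIntoBins m n).real
            {x | c' * i * √(heavyMedian m n i)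
                  + 4 * (i : ℝ) * √(c * heavyMedian m n i * Real.log m) ≤
                |heavyBallsRV m n i x - heavyMean m n i|}
          ≤ 1 / (m : ℝ) ^ c := by
  -- The case `m^c < 4` below needs `12 / c'² ≤ 1/4`, that is `c'² ≥ 48`.
  refine ⟨7, by norm_num, fun m n i c hm hn hi hc hM => ?_⟩
  have : NeZero n := ⟨by omega⟩
  have hm0 : (0 : ℝ) < m := by exact_mod_cast hm
  have hi' : (1 : ℝ) ≤ i := by exact_mod_cast hi
  have hpow : (m : ℝ) ^ c = Real.exp (c * Real.log m) := by
    rw [Real.rpow_def_of_pos hm0, mul_comm]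
  have hpow' : 1 / (m : ℝ) ^ c = Real.exp (-(c * Real.log m)) := by
    rw [hpow, Real.exp_neg, one_div]
  have h1 : 4 ≤ (m : ℝ) ^ c → (ballsIntoBins m n).real
      {x | 4 * (i : ℝ) * √(c * heavyMedian m n i * Real.log m) ≤
        |heavyBallsRV m n i x - heavyMedian m n i|} ≤ 1 / (m : ℝ) ^ c := by
    intro h4
    rw [hpow', show c * heavyMedian m n i * Real.log m =
      c * Real.log m * heavyMedian m n i by ring]
    exact heavyBalls_concentration hi (hpow ▸ h4) (by rw [← mul_assoc]; exact hM)
  refine ⟨h1, ?_⟩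
  -- A nonpositive median forces `log m = 0`, so `m = 1`; then `L_i` is identically 0 and the
  -- probability bound is the trivial 1.
  rcases le_or_gt (heavyMedian m n i) 0 with hM0 | hM0
  · have hm1 : m = 1 := by
      by_contra hne
      have hlog : 0 < Real.log m := Real.log_pos (by exact_mod_cast (by omega : 1 < m))
      have : 0 < 16 * (i : ℝ) ^ 2 * c * Real.log m := by positivity
      linarith
    subst hm1
    obtain ⟨hmed, hmean⟩ := heavyMean_one_eq_zero hM0
    refine ⟨by simp [hmed, hmean], ?_⟩
    rw [Nat.cast_one, Real.one_rpow, div_one]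
    exact measureReal_le_one
  have h2 := abs_median_sub_mean_le hi hn hM0
  refine ⟨h2, ?_⟩
  have hsq0 : 0 ≤ √(c * heavyMedian m n i * Real.log m) := Real.sqrt_nonneg _
  -- For `m^c < 4` the target exceeds 1/4, and Chebyshev at distance `7 i √M` already gives `12 i M
  -- / (49 i² M) ≤ 1/4`.
  rcases le_or_gt 4 ((m : ℝ) ^ c) with h4 | h4
  · refine le_trans (measureReal_mono fun x hx => ?_) (h1 h4)
    have hx' : 7 * i * √(heavyMedian m n i)
        + 4 * (i : ℝ) * √(c * heavyMedian m n i * Real.log m) ≤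
        |heavyBallsRV m n i x - heavyMean m n i| := hx
    change 4 * (i : ℝ) * √(c * heavyMedian m n i * Real.log m) ≤
      |heavyBallsRV m n i x - heavyMedian m n i|
    have := abs_sub_le (heavyBallsRV m n i x) (heavyMedian m n i) (heavyMean m n i)
    linarith
  · set M := heavyMedian m n i
    have hE := (heavyMean_le_of_median_pos hi hn hM0).2
    have hcheb := heavyBalls_chebyshev (i := i) hi hn (d := 7 * i * √M) (by positivity)
      (p := fun x => 7 * i * √M + 4 * (i : ℝ) * √(c * M * Real.log m) ≤
        |heavyBallsRV m n i x - heavyMean m n i|)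
      (fun x hx => le_trans (le_add_of_nonneg_right (by positivity)) hx)
    have hquarter : 1 / 4 ≤ 1 / (m : ℝ) ^ c :=
      one_div_le_one_div_of_le (by positivity) h4.le
    refine le_trans ?_ hquarter
    rw [mul_pow, Real.sq_sqrt hM0.le] at hcheb
    have hpos : 0 < (7 * (i : ℝ)) ^ 2 * M := by positivity
    refine le_of_mul_le_mul_right (hcheb.trans ?_) hpos
    have h5 : 2 * (i : ℝ) * heavyMean m n i ≤ 2 * i * (6 * M) := by gcongr
    have h6 : (i : ℝ) * M ≤ i ^ 2 * M := by
      refine mul_le_mul_of_nonneg_right ?_ hM0.le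
      nlinarith
    nlinarith [mul_pos (by positivity : 0 < (i : ℝ) ^ 2) hM0]
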